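/- Let $H$ be a complex Hilbert space, let $\mathcal M\subset B(H)$ be a von Neumann algebra with identity $\mathbf 1$, and let $\mathcal M_1=\{x\in\mathcal M:\|x\|\le 1\}$ be its closed unit ball. An element $x\in\mathcal M_1$ is called a $C^*$-extreme point of $\mathcal M_1$ if, whenever $x=\sum_{i=1}^k t_i^*x_it_i$ with $k\in\mathbb N$, $x_1,\dots,x_k\in\mathcal M_1$ and invertible $t_1,\dots,t_k\in\mathcal M$ satisfying $\sum_{i=1}^k t_i^*t_i=\mathbf 1$, there exist unitaries $u_1,\dots,u_k\in\mathcal M$ such that $x_i=u_i^*xu_i$ for $i=1,\dots,k$. For a Banach space $X$ with closed unit ball $X_1$, an element $x\in X_1$ is called a strongly extreme point of $X_1$ if, for all sequences $(x_n)$ and $(y_n)$ in $X_1$, $\frac{x_n+y_n}{2}\to x$ in norm implies $x_n-y_n\to 0$ in norm. Let $\Omega$ be a compact Hausdorff space, let $C(\Omega,\mathcal M)$ be the space of norm-continuous functions $\Omega\to\mathcal M$ with the supremum norm, and let $C(\Omega,\mathcal M)_1$ be its closed unit ball. Let $f\in C(\Omega,\mathcal M)_1$ be such that $f(\omega)$ is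 a $C^*$-extreme point of $\mathcal M_1$ for all $\omega\in\Omega$. Then $f$ is a strongly extreme point of $C(\Omega,\mathcal M)_1$. -/

import Mathlib

open Filter Topology

/-- A von Neumann algebra on `H` is closed under scalar multiplication. -/
instance VonNeumannAlgebra.instSMulMemClassComplex {H : Type*} [NormedAddCommGroup H]
    [InnerProductSpace ℂ H] [CompleteSpace H] :
    SMulMemClass (VonNeumannAlgebra H) ℂ (H →L[ℂ] H) where
  smul_mem {S} c _ hx := S.toStarSubalgebra.smul_mem hx c

/-- A von Neumann algebra on `H` is norm closed in the bounded operators, since it is a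
commutant; hence it is a (unital) C⋆-algebra with the structure inherited from `H →L[ℂ] H`. -/
instance VonNeumannAlgebra.instIsClosedCoe {H : Type*} [NormedAddCommGroup H]
    [InnerProductSpace ℂ H] [CompleteSpace H] (M : VonNeumannAlgebra H) :
    IsClosed (M : Set (H →L[ℂ] H)) := by
  rw [← M.centralizer_centralizer]
  exact Set.isClosed_centralizer _

/-- `x` is a C⋆-extreme point of the closed unit ball of the unital C⋆-algebra `A`:
`‖x‖ ≤ 1`, and whenever `x = ∑ᵢ tᵢ⋆ xᵢ tᵢ` is a proper C⋆-convex combination of finitely many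
elements `xᵢ` of the closed unit ball (all `tᵢ` invertible in `A`, `∑ᵢ tᵢ⋆ tᵢ = 1`), every `xᵢ`
is unitarily equivalent to `x` in `A`. -/
def IsCStarExtremePointUnitBall {A : Type*} [CStarAlgebra A] (x : A) : Prop :=
  ‖x‖ ≤ 1 ∧
    ∀ (k : ℕ) (y t : Fin k → A),
      (∀ i, ‖y i‖ ≤ 1) → (∀ i, IsUnit (t i)) → ∑ i, star (t i) * t i = 1 →
      x = ∑ i, star (t i) * y i * t i →
      ∀ i, ∃ u ∈ unitary A, y i = star u * x * u

/-- `x` is a strongly extreme point of the closed unit ball of the normed space `X`: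
`‖x‖ ≤ 1`, and for all sequences `yₙ`, `zₙ` in the closed unit ball,
`(yₙ + zₙ) / 2 → x` in norm implies `yₙ - zₙ → 0` in norm. -/
def IsStronglyExtremePointUnitBall {X : Type*} [NormedAddCommGroup X] [NormedSpace ℝ X]
    (x : X) : Prop :=
  ‖x‖ ≤ 1 ∧
    ∀ y z : ℕ → X, (∀ n, ‖y n‖ ≤ 1) → (∀ n, ‖z n‖ ≤ 1) →
      Tendsto (fun n => (2⁻¹ : ℝ) • (y n + z n)) atTop (𝓝 x) →
      Tendsto (fun n => y n - z n) atTop (𝓝 0)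

/-! A contraction `x = u|x|` in `M` is the midpoint of the partial isometries `uW` and `uW⋆`, where
`W` is a unitary with real part `|x|`. C⋆-extremality makes `x` unitarily equivalent to `uW`, hence
a partial isometry `v`. Perturbing `v` by `±b` with `b` in the corner `(1 - vv⋆) M (1 - v⋆v)` then
shows that this corner is zero. For such `v`, `norm_sub_le_of_partialIsometry` bounds `‖y - z‖` by
the distance of the midpoint from `v`, with constants independent of `v`; so the pointwise bounds
give one in the supremum norm. -/

/-! ### Quantitative strong extremality of partial isometries -/

section PartialIsometry

variable {A : Type*} [CStarAlgebra A]

/-- If `v` is a partial isometry, then `v⋆v` is a projection. -/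
theorem isStarProjection_star_mul_self {v : A} (hv : v * star v * v = v) :
    IsStarProjection (star v * v) where
  isIdempotentElem := by
    rw [IsIdempotentElem, mul_assoc, ← mul_assoc v, hv]
  isSelfAdjoint := .star_mul_self v

theorem norm_le_one_of_mul_star_mul_self {v : A} (hv : v * star v * v = v) : ‖v‖ ≤ 1 := by
  have h := (IsSelfAdjoint.star_mul_self v).norm_mul_self
  rw [(isStarProjection_star_mul_self hv).isIdempotentElem.eq, CStarRing.norm_star_mul_self] at h
  by_contra! h1
  have h2 : 1 < ‖v‖ * ‖v‖ := by nlinarith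
  nlinarith

/-- The midpoint `v` of two contractions determines them, up to a quantitative error,
on the initial space of `v`. -/
theorem norm_half_sub_mul_star_mul_self_sq_le {v y z : A} (hv : v * star v * v = v)
    (hy : ‖y‖ ≤ 1) (hz : ‖z‖ ≤ 1) :
    ‖(2⁻¹ : ℝ) • (y - z) * (star v * v)‖ ^ 2 ≤ 2 * ‖(2⁻¹ : ℝ) • (y + z) - v‖ := by
  let _ := CStarAlgebra.spectralOrder A
  let _ := CStarAlgebra.spectralOrderedRing A
  set m := (2⁻¹ : ℝ) • (y + z) with hm
  set d := (2⁻¹ : ℝ) • (y - z) with hd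
  have hp := isStarProjection_star_mul_self hv
  set p := star v * v with hpdef
  have hp1 : ‖p‖ ≤ 1 := by
    rw [hpdef, CStarRing.norm_star_mul_self]
    have := norm_le_one_of_mul_star_mul_self hv
    nlinarith [norm_nonneg v]
  have hm1 : ‖m‖ ≤ 1 := by
    rw [hm, norm_smul]
    have := norm_add_le y z
    norm_num
    linarith
  have contr : ∀ {a : A}, ‖a‖ ≤ 1 → star a * a ≤ 1 := fun {a} ha => by
    rw [← CStarAlgebra.norm_le_one_iff_of_nonneg _ (star_mul_self_nonneg a),
      CStarRing.norm_star_mul_self]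
    nlinarith [norm_nonneg a]
  -- Parallelogram law: it bounds `d⋆d` by the defect `1 - m⋆m` of the midpoint.
  have par : star d * d + star m * m = (2⁻¹ : ℝ) • (star y * y + star z * z) := by
    simp only [hm, hd, star_smul, star_add, star_sub, smul_mul_smul_comm, star_trivial]
    have : ((2⁻¹ : ℝ) * 2⁻¹) = 4⁻¹ := by norm_num
    rw [this]
    simp only [mul_add, add_mul, mul_sub, sub_mul]
    module
  have hle : star d * d ≤ 1 - star m * m := by
    rw [le_sub_iff_add_le, par]
    calc (2⁻¹ : ℝ) • (star y * y + star z * z) ≤ (2⁻¹ : ℝ) • ((1 : A) + 1) :=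
          smul_le_smul_of_nonneg_left (add_le_add (contr hy) (contr hz)) (by norm_num)
      _ = 1 := by module
  have hconj := star_left_conjugate_le_conjugate hle p
  have hpp : star p = p := hp.isSelfAdjoint.star_eq
  have e1 : star p * (star d * d) * p = star (d * p) * (d * p) := by
    simp [star_mul, mul_assoc]
  -- Between the two factors `p`, `1` may be replaced by `v⋆v`, and `v⋆v - m⋆m` is of first order in
  -- `v - m`.
  have e2 : star p * (1 - star m * m) * p
      = p * (star v * (v - m) + star (v - m) * m) * p := by
    have : star v * (v - m) + star (v - m) * m = p - star m * m := by
      rw [star_sub, hpdef]; noncomm_ring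
    rw [this, hpp]
    simp only [mul_sub, sub_mul, mul_one, hp.isIdempotentElem.eq]
  rw [e1, e2] at hconj
  have hn := CStarAlgebra.norm_le_norm_of_nonneg_of_le (star_mul_self_nonneg _) hconj
  rw [CStarRing.norm_star_mul_self] at hn
  have hv1 := norm_le_one_of_mul_star_mul_self hv
  have hb : ‖star v * (v - m) + star (v - m) * m‖ ≤ 2 * ‖m - v‖ := by
    rw [norm_sub_rev m v]
    calc _ ≤ ‖star v‖ * ‖v - m‖ + ‖star (v - m)‖ * ‖m‖ :=
          (norm_add_le _ _).trans (add_le_add (norm_mul_le _ _) (norm_mul_le _ _))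
      _ ≤ 1 * ‖v - m‖ + ‖v - m‖ * 1 := by
          rw [norm_star, norm_star]; gcongr
      _ = 2 * ‖v - m‖ := by ring
  calc ‖d * p‖ ^ 2 = ‖d * p‖ * ‖d * p‖ := sq _
    _ ≤ _ := hn
    _ ≤ ‖p‖ * ‖star v * (v - m) + star (v - m) * m‖ * ‖p‖ :=
        (norm_mul_le _ _).trans (by gcongr; exact norm_mul_le _ _)
    _ ≤ 1 * ‖star v * (v - m) + star (v - m) * m‖ * 1 := by gcongr
    _ ≤ 2 * ‖m - v‖ := by rw [one_mul, mul_one]; exact hb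

/-- A partial isometry `v` with `(1 - vv⋆) A (1 - v⋆v) = 0` is a strongly extreme point of the unit
ball, with a modulus that does not depend on `v`. -/
theorem norm_sub_le_of_partialIsometry {v y z : A} (hv : v * star v * v = v)
    (hext : ∀ a, (1 - v * star v) * a * (1 - star v * v) = 0)
    (hy : ‖y‖ ≤ 1) (hz : ‖z‖ ≤ 1) :
    ‖y - z‖ ≤ 6 * √(2 * ‖(2⁻¹ : ℝ) • (y + z) - v‖) := by
  set d := (2⁻¹ : ℝ) • (y - z) with hd
  set r := √(2 * ‖(2⁻¹ : ℝ) • (y + z) - v‖) with hr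
  have hp : ‖d * (star v * v)‖ ≤ r :=
    Real.le_sqrt_of_sq_le (norm_half_sub_mul_star_mul_self_sq_le hv hy hz)
  have hv' : star v * star (star v) * star v = star v := by
    simpa [mul_assoc] using congrArg star hv
  have hq : ‖v * star v * d‖ ≤ r := by
    have h := norm_half_sub_mul_star_mul_self_sq_le hv' (y := star y) (z := star z)
      (by rwa [norm_star]) (by rwa [norm_star])
    have e1 : (2⁻¹ : ℝ) • (star y - star z) * (star (star v) * star v)
        = star (v * star v * d) := by
      simp [hd, mul_assoc]
    have e2 : (2⁻¹ : ℝ) • (star y + star z) - star v = star ((2⁻¹ : ℝ) • (y + z) - v) := by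
      simp
    rw [e1, e2, norm_star, norm_star] at h
    exact Real.le_sqrt_of_sq_le h
  have hp1 : ‖star v * v‖ ≤ 1 := by
    rw [CStarRing.norm_star_mul_self]
    nlinarith [norm_nonneg v, norm_le_one_of_mul_star_mul_self hv]
  -- This is `(1 - vv⋆) d (1 - v⋆v) = 0` expanded; each of the three terms has norm at most `r`.
  have dec : d = v * star v * d + (d * (star v * v) - v * star v * d * (star v * v)) := by
    have h := hext d
    rw [← sub_eq_zero, ← h]
    noncomm_ring
  have hdn : ‖d‖ ≤ 3 * r := by
    calc ‖d‖ ≤ ‖v * star v * d‖ + (‖d * (star v * v)‖ + ‖v * star v * d * (star v * v)‖) := by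
          conv_lhs => rw [dec]
          exact (norm_add_le _ _).trans (by gcongr; exact norm_sub_le _ _)
      _ ≤ r + (r + r * 1) := by
          gcongr
          exact (norm_mul_le _ _).trans (by gcongr)
      _ = 3 * r := by ring
  have : y - z = (2 : ℝ) • d := by rw [hd]; module
  rw [this, norm_smul]
  norm_num
  linarith

end PartialIsometry

/-! ### Consequences of C⋆-extremality -/

section CStarExtreme

variable {A : Type*} [CStarAlgebra A]

/-- If a C⋆-extreme point is a midpoint of two contractions, it is unitarily equivalent to them. -/
theorem IsCStarExtremePointUnitBall.exists_unitary_of_midpoint {x y z : A}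
    (hx : IsCStarExtremePointUnitBall x) (hy : ‖y‖ ≤ 1) (hz : ‖z‖ ≤ 1)
    (h : x = (2⁻¹ : ℝ) • (y + z)) : ∃ u ∈ unitary A, y = star u * x * u := by
  have hs : √(2⁻¹ : ℝ) * √(2⁻¹ : ℝ) = 2⁻¹ := Real.mul_self_sqrt (by norm_num)
  have key : ∀ a : A, star (√(2⁻¹ : ℝ) • (1 : A)) * a * (√(2⁻¹ : ℝ) • (1 : A))
      = (2⁻¹ : ℝ) • a := fun a => by
    rw [star_smul, star_one, star_trivial, smul_mul_assoc, one_mul, smul_mul_smul_comm, hs, mul_one]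
  refine hx.2 2 ![y, z] (fun _ => √(2⁻¹ : ℝ) • 1) ?_ ?_ ?_ ?_ 0
  · intro i; fin_cases i <;> simpa
  · intro i
    have : √(2⁻¹ : ℝ) ≠ 0 := (Real.sqrt_pos.2 (by norm_num)).ne'
    exact ⟨Units.mk0 _ this • 1, rfl⟩
  · have := key 1
    rw [mul_one] at this
    simp only [Fin.sum_univ_two, this]
    module
  · simp only [Fin.sum_univ_two, key]
    simp [h]

/-- Partial isometries are preserved by unitary equivalence. -/
theorem mul_star_mul_self_of_unitary_conj {x y u : A} (hu : u ∈ unitary A)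
    (h : y = star u * x * u) (hy : y * star y * y = y) : x * star x * x = x := by
  have h1 := Unitary.star_mul_self_of_mem hu
  have h2 := Unitary.mul_star_self_of_mem hu
  have hx : x = u * y * star u := by
    rw [h]
    calc x = (u * star u) * x * (u * star u) := by simp [h2]
      _ = _ := by simp only [mul_assoc]
  calc x * star x * x = u * y * (star u * u) * star y * (star u * u) * y * star u := by
        rw [hx]; simp only [star_mul, star_star, mul_assoc]
    _ = u * (y * star y * y) * star u := by rw [h1]; simp only [mul_one, mul_assoc]
    _ = x := by rw [hy, hx]

/-- A partial isometry which is C⋆-extreme satisfies Kadison's criterion for extreme points. -/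
theorem IsCStarExtremePointUnitBall.one_sub_mul_one_sub_eq_zero {v : A}
    (hext : IsCStarExtremePointUnitBall v) (hv : v * star v * v = v) (a : A) :
    (1 - v * star v) * a * (1 - star v * v) = 0 := by
  let _ := CStarAlgebra.spectralOrder A
  let _ := CStarAlgebra.spectralOrderedRing A
  have hp := isStarProjection_star_mul_self hv
  have hv' : star v * v * star v = star v := by
    simpa [mul_assoc] using congrArg star hv
  set a₀ := (1 - v * star v) * a * (1 - star v * v) with ha₀
  -- Any bound below `1` on `‖b‖` would do: `b` will turn out to be a partial isometry, and a
  -- nonzero one has norm `1`.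
  set c : ℝ := (2 * (‖a₀‖ + 1))⁻¹ with hc
  have hcpos : 0 < c := by positivity
  set b := c • a₀ with hb
  have hbn : ‖b‖ ≤ 1 / 2 := by
    rw [hb, norm_smul, Real.norm_of_nonneg hcpos.le, hc, mul_inv, mul_assoc]
    have : (‖a₀‖ + 1)⁻¹ * ‖a₀‖ ≤ 1 := by
      rw [inv_mul_le_one₀ (by positivity)]; linarith
    linarith
  have hvb : star v * b = 0 := by
    rw [hb, mul_smul_comm, ha₀, ← mul_assoc, ← mul_assoc, mul_sub (star v) 1, mul_one,
      ← mul_assoc, hv', sub_self, zero_mul, zero_mul, smul_zero]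
  have hbv : b * star v = 0 := by
    rw [hb, smul_mul_assoc, ha₀, mul_assoc, sub_mul 1 (star v * v), one_mul, hv', sub_self,
      mul_zero, smul_zero]
  have hbv' : star b * v = 0 := by simpa using congrArg star hvb
  have hvb' : v * star b = 0 := by simpa using congrArg star hbv
  -- `v` and `b'` have orthogonal initial and final spaces, so adding `b'` keeps the norm at most
  -- `1`; needed for both `b` and `-b`.
  have norm_le : ∀ b' : A, star v * b' = 0 → b' * star v = 0 → ‖b'‖ ≤ 1 / 2 → ‖v + b'‖ ≤ 1 := by
    intro b' h1 h2 h3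
    have h1' : star b' * v = 0 := by simpa using congrArg star h1
    have e : star (v + b') * (v + b') = star v * v + star b' * b' := by
      rw [star_add, add_mul, mul_add, mul_add, h1, h1', zero_add, add_zero]
    have e' : star b' * b' = star (1 - star v * v) * (star b' * b') * (1 - star v * v) := by
      have h2' : b' * (1 - star v * v) = b' := by
        rw [mul_sub, ← mul_assoc, h2, mul_one, zero_mul, sub_zero]
      have h2'' : star (1 - star v * v) * star b' = star b' := by rw [← star_mul, h2']
      rw [← mul_assoc, h2'', mul_assoc, h2']
    have hle : star b' * b' ≤ 1 := by
      rw [← CStarAlgebra.norm_le_one_iff_of_nonneg _ (star_mul_self_nonneg b'),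
        CStarRing.norm_star_mul_self]
      nlinarith [norm_nonneg b']
    have hle' : star b' * b' ≤ 1 - star v * v := by
      rw [e']
      refine (star_left_conjugate_le_conjugate hle _).trans_eq ?_
      rw [mul_one, hp.one_sub.isSelfAdjoint.star_eq, hp.one_sub.isIdempotentElem.eq]
    have : ‖star (v + b') * (v + b')‖ ≤ 1 := by
      rw [CStarAlgebra.norm_le_one_iff_of_nonneg _ (star_mul_self_nonneg _), e]
      exact (add_le_add_right hle' _).trans_eq (by abel)
    rw [CStarRing.norm_star_mul_self] at this
    nlinarith [norm_nonneg (v + b')]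
  obtain ⟨u, hu, huv⟩ := hext.exists_unitary_of_midpoint (y := v + b) (z := v + -b)
    (norm_le b hvb hbv hbn) (norm_le (-b) (by simp [hvb]) (by simp [hbv]) (by simpa using hbn))
    (by module)
  have hpi : (v + b) * star (v + b) * (v + b) = v + b := by
    have hu' : star u ∈ unitary A := Unitary.star_mem hu
    refine mul_star_mul_self_of_unitary_conj hu' (y := v) ?_ hv
    have h2 := Unitary.mul_star_self_of_mem hu
    rw [huv, star_star]
    calc v = (u * star u) * v * (u * star u) := by simp [h2]
      _ = _ := by simp only [mul_assoc]
  have hbb : b * star b * b = b := by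
    have : (v + b) * star (v + b) * (v + b) = v * star v * v + b * star b * b := by
      simp only [star_add, add_mul, mul_add, hvb', hbv, mul_assoc, hvb, hbv']
      simp
    rw [this, hv] at hpi
    exact add_left_cancel hpi
  have hbz : b = 0 := by
    have hid := (isStarProjection_star_mul_self hbb).isIdempotentElem.eq
    have h := (IsSelfAdjoint.star_mul_self b).norm_mul_self
    rw [hid, CStarRing.norm_star_mul_self] at h
    by_contra hne
    have : 0 < ‖b‖ := norm_pos_iff.2 hne
    have hpos : 0 < ‖b‖ * ‖b‖ := mul_pos this this
    have hle : ‖b‖ * ‖b‖ ≤ 1 / 4 := by nlinarith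
    nlinarith
  exact (smul_eq_zero.1 hbz).resolve_left hcpos.ne'

end CStarExtreme

/-! ### Polar decomposition inside a von Neumann algebra -/

section Polar

variable {H : Type*} [NormedAddCommGroup H] [InnerProductSpace ℂ H] [CompleteSpace H]

theorem commute_cfcAbs_right {a x : H →L[ℂ] H} (h : Commute a x) (h' : Commute a (star x)) :
    Commute a (CFC.abs x) :=
  (h.symm.cfcAbs_left (commute_star_comm.1 h'.symm)).symm

/-- Polar decomposition `x = u |x|` of a bounded operator: `u` is a partial isometry, and its
initial space is the closure of the range of `|x|`. -/
theorem exists_polar_decomposition (x : H →L[ℂ] H) :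
    ∃ u : H →L[ℂ] H, u * CFC.abs x = x ∧ u * star u * u = u ∧
      star u * u * CFC.abs x = CFC.abs x ∧
      ∀ T : H →L[ℂ] H, T * CFC.abs x = 0 → T * (star u * u) = 0 := by
  set h := CFC.abs x with hh
  have hsa : star h = h := (CFC.abs_nonneg x).isSelfAdjoint.star_eq
  have hnorm : ∀ ξ, ‖h ξ‖ = ‖x ξ‖ := by
    intro ξ
    have e : (star h * h) = star x * x := by rw [hsa, hh, CFC.abs_mul_abs]
    have e1 := ContinuousLinearMap.apply_norm_eq_sqrt_inner_adjoint_left h ξ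
    have e2 := ContinuousLinearMap.apply_norm_eq_sqrt_inner_adjoint_left x ξ
    rw [e1, e2]
    have := DFunLike.congr_fun e ξ
    simp only [ContinuousLinearMap.star_eq_adjoint, mul_apply_eq_comp] at this
    simp [this]
  let K : Submodule ℂ H := (LinearMap.range (h : H →ₗ[ℂ] H)).topologicalClosure
  have hK : IsClosed (K : Set H) := Submodule.isClosed_topologicalClosure _
  have : CompleteSpace K := hK.completeSpace_coe
  have hmem : ∀ ξ, h ξ ∈ K := fun ξ => Submodule.le_topologicalClosure _ ⟨ξ, rfl⟩
  let e : H →ₗ[ℂ] K := LinearMap.codRestrict K (h : H →ₗ[ℂ] H) hmem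
  have hdense : DenseRange e := by
    intro k
    rw [closure_subtype]
    have hk : (k : H) ∈ closure (Set.range h) := k.2
    refine closure_mono ?_ hk
    rintro _ ⟨ξ, rfl⟩
    exact ⟨e ξ, ⟨ξ, rfl⟩, rfl⟩
  have hbd : ∀ ξ, ‖(x : H →ₗ[ℂ] H) ξ‖ ≤ 1 * ‖e ξ‖ := fun ξ => by
    rw [one_mul]; exact (hnorm ξ).ge
  -- `|x|ξ ↦ xξ` is isometric by `hnorm`, so it extends to the closure `K` of the range of `|x|`;
  -- `u` is zero on the complement of `K`.
  let u₀ : K →L[ℂ] H := (x : H →ₗ[ℂ] H).extendOfNorm e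
  have hu₀ : ∀ ξ, u₀ (e ξ) = x ξ := fun ξ => LinearMap.extendOfNorm_eq hdense ⟨1, hbd⟩ ξ
  have hiso : ∀ k, ‖u₀ k‖ = ‖k‖ := by
    intro k
    refine hdense.induction_on (p := fun k => ‖u₀ k‖ = ‖k‖) k
      (isClosed_eq (by fun_prop) (by fun_prop)) fun ξ => ?_
    rw [hu₀]; exact (hnorm ξ).symm
  let U₀ : K →ₗᵢ[ℂ] H := ⟨u₀.toLinearMap, hiso⟩
  let u : H →L[ℂ] H := u₀ ∘L K.orthogonalProjectionOnto
  have huu : star u * u = K.starProjection := by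
    ext ξ
    refine ext_inner_left ℂ fun η => ?_
    rw [ContinuousLinearMap.star_eq_adjoint, mul_apply_eq_comp,
      ContinuousLinearMap.adjoint_inner_right]
    have : inner ℂ (u η) (u ξ)
        = inner ℂ (K.orthogonalProjectionOnto η) (K.orthogonalProjectionOnto ξ) :=
      U₀.inner_map_map _ _
    rw [this, Submodule.coe_inner, ← Submodule.starProjection_apply,
      ← Submodule.starProjection_apply, Submodule.inner_starProjection_left_eq_right,
      Submodule.starProjection_eq_self_iff.2 (K.starProjection_apply_mem ξ)]
  have hPK : ∀ k ∈ K, K.starProjection k = k := fun k hk =>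
    Submodule.starProjection_eq_self_iff.2 hk
  refine ⟨u, ?_, ?_, ?_, ?_⟩
  · ext ξ
    change u₀ (K.orthogonalProjectionOnto (h ξ)) = x ξ
    rw [← hu₀ ξ]
    congr 1
    exact Submodule.orthogonalProjectionOnto_mem_subspace_eq_self (e ξ)
  · rw [mul_assoc, huu]
    ext ξ
    change u₀ (K.orthogonalProjectionOnto (K.orthogonalProjectionOnto ξ : H))
      = u₀ (K.orthogonalProjectionOnto ξ)
    rw [Submodule.orthogonalProjectionOnto_mem_subspace_eq_self]
  · rw [huu]
    ext ξ
    exact hPK _ (hmem ξ)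
  · intro T hT
    rw [huu]
    ext ξ
    have hle : K ≤ LinearMap.ker (T : H →ₗ[ℂ] H) := by
      refine Submodule.topologicalClosure_minimal _ ?_ T.isClosed_ker
      rintro _ ⟨η, rfl⟩
      exact DFunLike.congr_fun hT η
    exact hle (Submodule.starProjection_apply_mem K ξ)

namespace VonNeumannAlgebra

variable (M : VonNeumannAlgebra H)

/-- Bicommutant property: it brings operators constructed in `B(H)` back into `M`. -/
theorem mem_of_forall_commute {t : H →L[ℂ] H}
    (h : ∀ a : H →L[ℂ] H, (∀ m ∈ M, Commute a m) → Commute a t) : t ∈ M := by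
  rw [← M.commutant_commutant, mem_commutant_iff]
  intro a ha
  rw [mem_commutant_iff] at ha
  exact h a fun m hm => (ha m hm).symm

/-- The partial isometry in the polar decomposition of an element of a von Neumann algebra. -/
theorem exists_polar_decomposition {x : H →L[ℂ] H} (hx : x ∈ M) :
    ∃ u ∈ M, u * CFC.abs x = x ∧ u * star u * u = u := by
  obtain ⟨u, hux, hu, huh, hT⟩ := _root_.exists_polar_decomposition x
  refine ⟨u, M.mem_of_forall_commute fun a ha => ?_, hux, hu⟩
  set h := CFC.abs x
  set p := star u * u with hp
  have hsa : star h = h := (CFC.abs_nonneg x).isSelfAdjoint.star_eq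
  have hps : star p = p := (IsSelfAdjoint.star_mul_self u).star_eq
  have hax : a * x = x * a := ha x hx
  have hah : a * h = h * a :=
    commute_cfcAbs_right (ha x hx) (ha _ (star_mem hx))
  have hhp : h * p = h := by simpa [hsa, hps] using congrArg star huh
  have hup : u * p = u := by rw [hp, ← mul_assoc, hu]
  have h1 : (a * u - u * a) * p = 0 := hT _ <| by
    rw [sub_mul, mul_assoc, hux, mul_assoc, hah, ← mul_assoc, hux, hax, sub_self]
  -- `a` commutes with `h`, so it preserves `ker h`, the range of `1 - p`. Adjoints are taken
  -- because `hT` needs `h` on the right.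
  have h2 : p * a * (1 - p) = 0 := by
    have h3 : h * (a * (1 - p)) = 0 := by
      rw [← mul_assoc, ← hah, mul_assoc, mul_sub, mul_one, hhp, sub_self, mul_zero]
    have h4 := hT (star (a * (1 - p))) (by simpa [hsa] using congrArg star h3)
    simpa [hps, ← hp, mul_assoc] using congrArg star h4
  have h5 : u * a * (1 - p) = 0 := by
    rw [← hup, mul_assoc u, mul_assoc u, h2, mul_zero]
  have h6 : (a * u - u * a) * (1 - p) = 0 := by
    rw [sub_mul, h5, sub_zero, mul_assoc, mul_sub, hup, mul_one, sub_self, mul_zero]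
  rw [commute_iff_eq, ← sub_eq_zero]
  calc a * u - u * a = (a * u - u * a) * p + (a * u - u * a) * (1 - p) := by noncomm_ring
    _ = 0 := by rw [h1, h6, add_zero]

/-- Every contraction in a von Neumann algebra is the midpoint of two partial isometries. -/
theorem exists_midpoint_partialIsometry {x : H →L[ℂ] H} (hx : x ∈ M) (hx1 : ‖x‖ ≤ 1) :
    ∃ y ∈ M, ∃ z ∈ M, y * star y * y = y ∧ z * star z * z = z ∧ x = (2⁻¹ : ℝ) • (y + z) := by
  obtain ⟨u, huM, hux, hu⟩ := M.exists_polar_decomposition hx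
  have hsa : IsSelfAdjoint (CFC.abs x) := (CFC.abs_nonneg x).isSelfAdjoint
  have hn : ‖CFC.abs x‖ ≤ 1 := by rwa [CFC.norm_abs]
  -- `W = |x| + i√(1 - |x|²)`.
  let W := selfAdjoint.unitarySelfAddISMul ⟨CFC.abs x, hsa⟩ hn
  have hW1 : (W : H →L[ℂ] H) = CFC.abs x + Complex.I • CFC.sqrt (1 - CFC.abs x ^ 2) := rfl
  have hW2 : star (W : H →L[ℂ] H) = CFC.abs x - Complex.I • CFC.sqrt (1 - CFC.abs x ^ 2) :=
    selfAdjoint.star_coe_unitarySelfAddISMul _ hn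
  have hWM : (W : H →L[ℂ] H) ∈ M := M.mem_of_forall_commute fun a ha => by
    have hah : Commute a (CFC.abs x) :=
      commute_cfcAbs_right (ha x hx) (ha _ (star_mem hx))
    have has : Commute a (CFC.sqrt (1 - CFC.abs x ^ 2)) :=
      (((Commute.one_right a).sub_right (hah.pow_right 2)).symm.cfcₙ_nnreal _).symm
    rw [hW1]
    exact hah.add_right (has.smul_right _)
  have h1 : star (W : H →L[ℂ] H) * W = 1 := Unitary.star_mul_self_of_mem W.2
  have h2 : (W : H →L[ℂ] H) * star (W : H →L[ℂ] H) = 1 := Unitary.mul_star_self_of_mem W.2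
  refine ⟨u * W, mul_mem huM hWM, u * star (W : H →L[ℂ] H), mul_mem huM (star_mem hWM), ?_, ?_, ?_⟩
  · calc _ = u * (W * star (W : H →L[ℂ] H)) * star u * u * W := by
          simp only [star_mul, mul_assoc]
      _ = _ := by rw [h2, mul_one, hu]
  · calc _ = u * (star (W : H →L[ℂ] H) * W) * star u * u * star (W : H →L[ℂ] H) := by
          simp only [star_mul, star_star, mul_assoc]
      _ = _ := by rw [h1, mul_one, hu]
  · rw [← mul_add, hW2, hW1, ← mul_smul_comm]
    conv_lhs => rw [← hux]
    congr 1
    module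

/-- A C⋆-extreme point of the unit ball of a von Neumann algebra is a partial isometry. -/
theorem mul_star_mul_self_of_isCStarExtremePointUnitBall {x : M}
    (hx : IsCStarExtremePointUnitBall x) : x * star x * x = x := by
  obtain ⟨y, hyM, z, hzM, hy, hz, hxyz⟩ := M.exists_midpoint_partialIsometry x.2 hx.1
  lift y to M using hyM
  lift z to M using hzM
  have hy' : y * star y * y = y := Subtype.ext hy
  have hz' : z * star z * z = z := Subtype.ext hz
  have hxyz' : x = (2⁻¹ : ℝ) • (y + z) := Subtype.ext hxyz
  obtain ⟨u, hu, h⟩ := hx.exists_unitary_of_midpoint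
    (norm_le_one_of_mul_star_mul_self hy') (norm_le_one_of_mul_star_mul_self hz') hxyz'
  exact mul_star_mul_self_of_unitary_conj hu h hy'

end VonNeumannAlgebra

end Polar

theorem propositionp {H : Type*} [NormedAddCommGroup H] [InnerProductSpace ℂ H] [CompleteSpace H]
    (M : VonNeumannAlgebra H)
    {Ω : Type*} [TopologicalSpace Ω] [CompactSpace Ω] [T2Space Ω]
    (f : C(Ω, M)) (hf : ‖f‖ ≤ 1)
    (hext : ∀ ω : Ω, IsCStarExtremePointUnitBall (f ω)) :
    IsStronglyExtremePointUnitBall f := by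
  refine ⟨hf, fun y z hy hz hlim => ?_⟩
  have bound : ∀ n, ‖y n - z n‖ ≤ 6 * √(2 * ‖(2⁻¹ : ℝ) • (y n + z n) - f‖) := fun n => by
    refine (ContinuousMap.norm_le _ (by positivity)).2 fun ω => ?_
    have hv := M.mul_star_mul_self_of_isCStarExtremePointUnitBall (hext ω)
    refine (norm_sub_le_of_partialIsometry hv ((hext ω).one_sub_mul_one_sub_eq_zero hv)
      (((y n).norm_coe_le_norm ω).trans (hy n)) (((z n).norm_coe_le_norm ω).trans (hz n))).trans ?_
    gcongr
    exact ((2⁻¹ : ℝ) • (y n + z n) - f).norm_coe_le_norm ω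
  refine squeeze_zero_norm bound ?_
  have h0 : Tendsto (fun n => ‖(2⁻¹ : ℝ) • (y n + z n) - f‖) atTop (𝓝 0) :=
    tendsto_iff_norm_sub_tendsto_zero.1 hlim
  simpa using ((h0.const_mul 2).sqrt).const_mul 6
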